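/- For a nonnegative integer $n$ let $H_0=0$ and $H_n=\sum_{k=1}^n \frac1k$ for $n\ge 1$, and for an integer $u\neq 0$ let $$T_n^{(u)}=\sum_{k=0}^n\binom{n}{k}^{u}\bigl\{1+u(n-2k)H_k\bigr\}.$$ Then for all integers $m\ge 1$ and $n\ge 0$, $$T_n^{(2m+3)}=(-1)^n\sum_{0\le i_1\le i_2\le\cdots\le i_m\le n}\binom{n}{i_m}^2\binom{n+i_1}{n}\prod_{r=1}^{m-1}\binom{n}{i_r}^2\binom{n+i_{r+1}-i_r}{n},$$ where the sum runs over integers $i_1,\dots,i_m$, the product extends over both binomial factors, and an empty product (the case $m=1$) equals $1$. -/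

import Mathlib

/-- The sum `T_n^{(u)} = ∑_{k=0}^n C(n,k)^u {1 + u (n - 2k) H_k}` for an integer exponent `u`
(of interest for `u ≠ 0`); `harmonic k` is the harmonic number `H_k`. -/
def harmonicT (n : ℕ) (u : ℤ) : ℚ :=
  ∑ k ∈ Finset.range (n + 1),
    (n.choose k : ℚ) ^ u * (1 + (u : ℚ) * ((n : ℚ) - 2 * (k : ℚ)) * harmonic k)

/-- The finite set of integer tuples `0 ≤ i_1 ≤ i_2 ≤ ⋯ ≤ i_m ≤ n`; the entry `i_r` is the value
at the index `r - 1 : Fin m`. -/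
def weakChains (m n : ℕ) : Finset (Fin m → ℕ) :=
  (Fintype.piFinset fun _ : Fin m => Finset.range (n + 1)).filter
    fun i => ∀ r s : Fin m, r ≤ s → i r ≤ i s

/-! Write (x)_k for `rise x k`. The well-poised sum S(d) = ∑ (a+2k) (-1)^k (a)_k/k!
((-n)_k/(1+d)_k)^(2m+2), with a = d - n, has T_n^(2m+3) as its derivative at d = 0: differentiating
the factors produces harmonic numbers, and the reflection k ↦ n - k merges them
(`sum_deriv_eq_harmonicT`).

For non-integral d, S(d) is also computed by a Bailey chain: the unit pair, m Bailey steps with both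
parameters -n (`bailey_chain`), and one limiting step. This gives S(d) = d R(d), R a nested sum
continuous at 0 (`sum_well_poised`). Hence T_n^(2m+3) = R(0), and at d = 0 the rising factorials in
R become binomial coefficients (`chainCoeff_zero_right`). Unrolling the recursion gives the sum over
chains (`sum_weakChains_mul_prod`). -/

/-- The rising factorial `x (x + 1) ⋯ (x + n - 1)`. -/
def rise (x : ℚ) (n : ℕ) : ℚ := ∏ i ∈ Finset.range n, (x + i)

@[simp] lemma rise_zero (x : ℚ) : rise x 0 = 1 := by simp [rise]

lemma rise_succ (x : ℚ) (n : ℕ) : rise x (n + 1) = rise x n * (x + n) := by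
  simp [rise, Finset.prod_range_succ]

lemma rise_succ' (x : ℚ) (n : ℕ) : rise x (n + 1) = x * rise (x + 1) n := by
  simp only [rise, Finset.prod_range_succ', Nat.cast_zero, add_zero]
  rw [mul_comm]
  congr 1
  refine Finset.prod_congr rfl fun i _ => ?_
  push_cast
  ring

lemma rise_add (x : ℚ) (m n : ℕ) : rise x (m + n) = rise x m * rise (x + m) n := by
  simp only [rise, Finset.prod_range_add]
  congr 1
  refine Finset.prod_congr rfl fun i _ => ?_
  push_cast
  ring

lemma rise_ne_zero {x : ℚ} (h : ∀ i : ℕ, x + i ≠ 0) (n : ℕ) : rise x n ≠ 0 :=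
  Finset.prod_ne_zero_iff.mpr fun i _ => h i

lemma rise_natCast_succ_mul_factorial (n k : ℕ) :
    rise (n + 1) k * n.factorial = (n + k).factorial := by
  induction k with
  | zero => simp
  | succ k ih =>
    rw [rise_succ, ← add_assoc, Nat.factorial_succ]
    push_cast
    rw [← ih]
    ring

lemma rise_one (k : ℕ) : rise 1 k = k.factorial := by
  have := rise_natCast_succ_mul_factorial 0 k
  simpa using this

lemma rise_natCast_succ (n k : ℕ) :
    rise (n + 1) k = (n + k).choose n * k.factorial := by
  have h := rise_natCast_succ_mul_factorial n k
  have h2 : (((n + k).choose n * n.factorial * k.factorial : ℕ) : ℚ) = (n + k).factorial := by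
    rw [Nat.choose_symm_add]
    have := Nat.choose_mul_factorial_mul_factorial (Nat.le_add_left k n)
    rw [Nat.add_sub_cancel] at this
    rw [← this]
    push_cast
    ring
  have h3 : (n.factorial : ℚ) ≠ 0 := by exact_mod_cast n.factorial_ne_zero
  apply mul_right_cancel₀ h3
  rw [h, ← h2]
  push_cast
  ring

lemma rise_neg_natCast_mul_factorial (k j : ℕ) :
    rise (-((k + j : ℕ) : ℚ)) k * j.factorial = (-1) ^ k * (k + j).factorial := by
  induction k generalizing j with
  | zero => simp
  | succ k ih =>
    have := ih (j + 1)
    rw [show k + (j + 1) = k + 1 + j by ring] at this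
    rw [rise_succ, pow_succ]
    rw [Nat.factorial_succ] at this
    push_cast at this ⊢
    linear_combination (-1) * this

lemma rise_neg_natCast {n k : ℕ} (h : k ≤ n) :
    rise (-(n : ℚ)) k = (-1) ^ k * (n.choose k * k.factorial) := by
  obtain ⟨j, rfl⟩ := Nat.exists_eq_add_of_le h
  have h1 := rise_neg_natCast_mul_factorial k j
  have h2 := Nat.choose_mul_factorial_mul_factorial h
  rw [Nat.add_sub_cancel_left] at h2
  have h3 : (j.factorial : ℚ) ≠ 0 := by exact_mod_cast j.factorial_ne_zero
  apply mul_right_cancel₀ h3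
  rw [h1, ← h2]
  push_cast
  ring

/-! ### Terminating summations -/

open Finset in
/-- The Pfaff–Saalschütz summation, cleared of denominators. -/
lemma sum_saalschutz (M : ℕ) (A B D : ℚ) :
    ∑ p ∈ antidiagonal M, (M.choose p.1 : ℚ) *
      (rise A p.1 * rise B p.1 * rise D p.2 * rise (A + B + D + p.1) p.2) =
      rise (A + D) M * rise (B + D) M := by
  induction M generalizing A B D with
  | zero => simp
  | succ M ih =>
    rw [sum_antidiagonal_choose_succ_mul
      (fun i j => rise A i * rise B i * rise D j * rise (A + B + D + i) j)]
    have h1 := ih (A + 1) B D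
    have h2 := ih A B (D + 1)
    -- Split the factor A + D; the A part peels the last factor of (B+D)_(M+1), the D part its
    -- first.
    have key : rise (A + D) (M + 1) * rise (B + D) (M + 1) =
        (B + D + M) * A * (rise (A + 1 + D) M * rise (B + D) M) +
        (B + D) * D * (rise (A + (D + 1)) M * rise (B + (D + 1)) M) := by
      have e1 : rise (A + D) (M + 1) = (A + D) * rise (A + 1 + D) M := by
        rw [rise_succ']; congr 2; ring
      have e2 := rise_succ (B + D) M
      have e3 := rise_succ' (B + D) M
      rw [show A + (D + 1) = A + 1 + D by ring, ← add_assoc B D 1, e1]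
      linear_combination A * rise (A + 1 + D) M * e2 + D * rise (A + 1 + D) M * e3
    rw [key, ← h1, ← h2, mul_sum, mul_sum, ← sum_add_distrib, ← sum_add_distrib]
    refine sum_congr rfl fun p hp => ?_
    rw [HasAntidiagonal.mem_antidiagonal] at hp
    obtain ⟨i, j⟩ := p
    dsimp only at hp ⊢
    subst hp
    rw [Nat.choose_symm_add.symm]
    have a1 := rise_succ A i
    have a2 := rise_succ' A i
    have b1 := rise_succ B i
    have d1 := rise_succ D j
    have d2 := rise_succ' D j
    have c1 := rise_succ' (A + B + D + i) j
    have f1 : A * rise (A + 1) i = rise A i * (A + i) := by rw [← a1, a2]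
    have f2 : D * rise (D + 1) j = rise D j * (D + j) := by rw [← d1, d2]
    rw [a1, b1, d1, c1, show A + 1 + B + D + (i : ℚ) = A + B + D + i + 1 by ring,
      show A + B + (D + 1) + (i : ℚ) = A + B + D + i + 1 by ring]
    push_cast
    rw [show A + B + D + ((i : ℚ) + 1) = A + B + D + i + 1 by ring]
    set R := rise (A + B + D + i + 1) j
    set ch := (((i + j).choose i : ℕ) : ℚ)
    linear_combination (-(B + D + (i + j)) * ch * rise B i * rise D j * R) * f1
      - (B + D) * ch * rise A i * rise B i * R * f2

open Finset in
/-- The Chu–Vandermonde summation, cleared of denominators. -/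
lemma sum_chu_vandermonde (M : ℕ) (A C : ℚ) :
    ∑ p ∈ antidiagonal M, (M.choose p.1 : ℚ) *
      ((-1) ^ p.1 * rise A p.1 * rise (C + p.1) p.2) = rise (C - A) M := by
  induction M generalizing C with
  | zero => simp
  | succ M ih =>
    rw [sum_antidiagonal_choose_succ_mul
      (fun i j => (-1) ^ i * rise A i * rise (C + i) j)]
    have h1 := ih (C + 1)
    rw [rise_succ', show C - A + 1 = C + 1 - A by ring, ← h1, mul_sum, ← sum_add_distrib]
    refine sum_congr rfl fun p hp => ?_
    rw [HasAntidiagonal.mem_antidiagonal] at hp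
    obtain ⟨i, j⟩ := p
    dsimp only at hp ⊢
    subst hp
    rw [Nat.choose_symm_add.symm, rise_succ', rise_succ, pow_succ]
    push_cast
    rw [show C + ((i : ℚ) + 1) = C + i + 1 by ring, show C + 1 + (i : ℚ) = C + i + 1 by ring]
    ring

-- The sum telescopes: its partial sums have a closed form containing `M.choose K`, which vanishes
-- at K = M + 1.
open Finset in
lemma sum_alternating_choose_div_rise (M : ℕ) (a : ℚ) (ha : ∀ i : ℕ, a + i ≠ 0) :
    ∑ k ∈ range (M + 2), (-1) ^ k * ((M + 1).choose k : ℚ) * (a + 2 * k) / rise (a + k) (M + 2)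
      = 0 := by
  have key : ∀ K : ℕ, ∑ k ∈ range (K + 1),
      (-1) ^ k * ((M + 1).choose k : ℚ) * (a + 2 * k) / rise (a + k) (M + 2) =
      (-1) ^ K * (M.choose K : ℚ) / rise (a + K + 1) (M + 1) := by
    intro K
    induction K with
    | zero =>
      simp only [zero_add, range_one, sum_singleton, rise_succ' _ (M + 1)]
      have h0 := ha 0
      simp only [Nat.cast_zero, add_zero] at h0
      simp
      field_simp
    | succ K ih =>
      rw [sum_range_succ, ih]
      have h1 : ∀ i : ℕ, a + (K + 1 : ℕ) + i ≠ 0 := fun i => by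
        have := ha (K + 1 + i); push_cast at this ⊢; rwa [← add_assoc] at this
      have h2 : ∀ i : ℕ, a + (K + 1 : ℕ) + 1 + i ≠ 0 := fun i => by
        have := h1 (1 + i); push_cast at this ⊢; rwa [← add_assoc] at this
      have hr := rise_ne_zero h2 M
      have e0 : rise (a + K + 1) (M + 1) = (a + (K + 1 : ℕ)) * rise (a + (K + 1 : ℕ) + 1) M := by
        rw [rise_succ']; push_cast; simp only [add_assoc]
      have e1 : rise (a + (K + 1 : ℕ)) (M + 2) = (a + (K + 1 : ℕ)) *
          (rise (a + (K + 1 : ℕ) + 1) M * (a + (K + 1 : ℕ) + 1 + M)) := by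
        rw [rise_succ', rise_succ]
      have e2 := rise_succ (a + (K + 1 : ℕ) + 1) M
      have g0 := h1 0
      have g1 := h2 M
      simp only [Nat.cast_zero, add_zero] at g0
      rw [e0, e1, e2, pow_succ]
      have c1 : ((M + 1).choose (K + 1) : ℚ) = M.choose K + M.choose (K + 1) := by
        rw [Nat.choose_succ_succ]; push_cast; ring
      have c2 : ((K : ℚ) + 1) * M.choose (K + 1) = (M - K) * M.choose K := by
        rcases le_or_gt K M with h | h
        · have := Nat.choose_succ_right_eq M K
          have := congrArg (Nat.cast : ℕ → ℚ) this
          push_cast [Nat.cast_sub h] at this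
          linarith
        · rw [Nat.choose_eq_zero_of_lt h, Nat.choose_eq_zero_of_lt (by omega)]; simp
      rw [c1]
      generalize rise (a + (K + 1 : ℕ) + 1) M = R at *
      push_cast at *
      field_simp
      linear_combination (-1) * c2
  rw [key (M + 1)]
  simp

/-! ### Bailey pairs -/

/-- The sequence `β` attached to a sequence `α` in a Bailey pair relative to `a` (at `q = 1`). -/
def bailey (a : ℚ) (α : ℕ → ℚ) (N : ℕ) : ℚ :=
  ∑ k ∈ Finset.range (N + 1), α k / ((N - k).factorial * rise (a + 1) (N + k))

open Finset in
/-- Bailey's transform: summing `bailey a α` against a kernel that reproduces the weights `w`. -/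
lemma sum_mul_bailey (a : ℚ) (α w : ℕ → ℚ) (K : ℕ → ℚ) (N : ℕ)
    (h : ∀ k M, N = k + M → ∑ s ∈ range (M + 1),
        K (k + s) / (s.factorial * rise (a + 1) (k + s + k)) =
      w k / (M.factorial * rise (a + 1) (N + k))) :
    ∑ j ∈ range (N + 1), K j * bailey a α j = bailey a (fun k => w k * α k) N := by
  simp only [bailey, mul_sum, range_eq_Ico]
  rw [← sum_Ico_Ico_comm]
  refine sum_congr rfl fun k hk => ?_
  obtain ⟨M, rfl⟩ := Nat.exists_eq_add_of_le (Nat.lt_succ_iff.mp (mem_Ico.mp hk).2)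
  rw [sum_Ico_eq_sum_range, show k + M + 1 - k = M + 1 by omega, Nat.add_sub_cancel_left,
    mul_div_right_comm, ← h k M rfl, sum_mul]
  refine sum_congr rfl fun s _ => ?_
  rw [Nat.add_sub_cancel_left]
  ring

lemma factorial_add_eq (i j : ℕ) :
    ((i + j).factorial : ℚ) = (i + j).choose i * i.factorial * j.factorial := by
  have := Nat.choose_mul_factorial_mul_factorial (Nat.le_add_right i j)
  rw [Nat.add_sub_cancel_left] at this
  exact_mod_cast this.symm

open Finset in
/-- Bailey's lemma at `q = 1`. -/
lemma bailey_step (a b c : ℚ) (α : ℕ → ℚ) (N : ℕ) (ha : ∀ i : ℕ, a + 1 + i ≠ 0)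
    (hb : ∀ i : ℕ, 1 + a - b + i ≠ 0) (hc : ∀ i : ℕ, 1 + a - c + i ≠ 0) :
    ∑ j ∈ range (N + 1), rise b j * rise c j * rise (1 + a - b - c) (N - j) /
        ((N - j).factorial * (rise (1 + a - b) N * rise (1 + a - c) N)) * bailey a α j =
      bailey a (fun k => rise b k * rise c k / (rise (1 + a - b) k * rise (1 + a - c) k) * α k)
        N := by
  refine sum_mul_bailey a α _ _ N ?_
  rintro k M rfl
  have hf : ∀ n : ℕ, (n.factorial : ℚ) ≠ 0 := fun n => by exact_mod_cast n.factorial_ne_zero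
  -- With j = k + s, the shifted parameters add up to a + 1 + 2k, the base left in (a+1)_(2k+s) once
  -- (a+1)_(2k) is removed.
  have S := sum_saalschutz M (b + k) (c + k) (1 + a - b - c)
  rw [Nat.sum_antidiagonal_eq_sum_range_succ_mk] at S
  rw [show b + k + (1 + a - b - c) = 1 + a - c + k by ring,
    show c + k + (1 + a - b - c) = 1 + a - b + k by ring,
    show b + k + (c + k) + (1 + a - b - c) = a + 1 + 2 * k by ring] at S
  have hC : ∀ i : ℕ, a + 1 + 2 * k + i ≠ 0 := fun i => by
    have := ha (2 * k + i); push_cast at this; rwa [← add_assoc] at this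
  have hbN := rise_ne_zero hb (k + M)
  have hcN := rise_ne_zero hc (k + M)
  have hbk := rise_ne_zero hb k
  have hck := rise_ne_zero hc k
  have ha2 := rise_ne_zero ha (k + k)
  have hCM := rise_ne_zero hC M
  have r0 : ∀ s, rise (a + 1) (k + s + k) = rise (a + 1) (k + k) * rise (a + 1 + 2 * k) s := by
    intro s
    rw [show k + s + k = k + k + s by ring, rise_add]
    congr 2; push_cast; ring
  have bN := rise_add (1 + a - b) k M
  have cN := rise_add (1 + a - c) k M
  calc _ = ∑ s ∈ range (M + 1), rise b k * rise c k /
        (M.factorial * (rise (1 + a - b) (k + M) * rise (1 + a - c) (k + M)) *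
          (rise (a + 1) (k + k) * rise (a + 1 + 2 * k) M)) *
          ((M.choose s : ℚ) * (rise (b + k) s * rise (c + k) s *
            rise (1 + a - b - c) (M - s) * rise (a + 1 + 2 * k + s) (M - s))) := by
        refine sum_congr rfl fun s hs => ?_
        obtain ⟨j, rfl⟩ := Nat.exists_eq_add_of_le (Nat.lt_succ_iff.mp (mem_range.mp hs))
        rw [show k + (s + j) - (k + s) = j by omega, Nat.add_sub_cancel_left, r0,
          rise_add (a + 1 + 2 * k) s j, rise_add b k s, rise_add c k s,
          factorial_add_eq s j]
        have h1 := rise_ne_zero hC (s + j)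
        rw [rise_add] at h1
        have h2 := left_ne_zero_of_mul h1
        have h3 := right_ne_zero_of_mul h1
        have h4 : ((s + j).choose s : ℚ) ≠ 0 := by
          exact_mod_cast (Nat.choose_pos (Nat.le_add_right s j)).ne'
        have h5 := hf s
        have h6 := hf j
        generalize rise (a + 1 + 2 * k + s) j = R₁ at h3 ⊢
        generalize rise (a + 1 + 2 * k) s = R₂ at h2 ⊢
        field_simp
    _ = _ := by
        rw [← mul_sum, S, r0 M, bN, cN]
        rw [bN] at hbN
        rw [cN] at hcN
        have h1 := right_ne_zero_of_mul hbN
        have h2 := right_ne_zero_of_mul hcN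
        have h3 := hf M
        field_simp

open Finset in
/-- The terminating limiting case `c → ∞`, with parameter `-N`, of Bailey's lemma. -/
lemma bailey_step_limit (a b : ℚ) (α : ℕ → ℚ) (N : ℕ) (ha : ∀ i : ℕ, a + 1 + i ≠ 0)
    (hb : ∀ i : ℕ, 1 + a - b + i ≠ 0) :
    ∑ j ∈ range (N + 1), (-1) ^ j * rise b j /
        ((N - j).factorial * rise (1 + a - b) N) * bailey a α j =
      bailey a (fun k => (-1) ^ k * rise b k / rise (1 + a - b) k * α k) N := by
  refine sum_mul_bailey a α _ _ N ?_
  rintro k M rfl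
  have hf : ∀ n : ℕ, (n.factorial : ℚ) ≠ 0 := fun n => by exact_mod_cast n.factorial_ne_zero
  have S := sum_chu_vandermonde M (b + k) (a + 1 + 2 * k)
  rw [Nat.sum_antidiagonal_eq_sum_range_succ_mk] at S
  rw [show a + 1 + 2 * k - (b + k) = 1 + a - b + k by ring] at S
  have hC : ∀ i : ℕ, a + 1 + 2 * k + i ≠ 0 := fun i => by
    have := ha (2 * k + i); push_cast at this; rwa [← add_assoc] at this
  have hbN := rise_ne_zero hb (k + M)
  have hbk := rise_ne_zero hb k
  have ha2 := rise_ne_zero ha (k + k)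
  have hCM := rise_ne_zero hC M
  have r0 : ∀ s, rise (a + 1) (k + s + k) = rise (a + 1) (k + k) * rise (a + 1 + 2 * k) s := by
    intro s
    rw [show k + s + k = k + k + s by ring, rise_add]
    congr 2; push_cast; ring
  have bN := rise_add (1 + a - b) k M
  calc _ = ∑ s ∈ range (M + 1), (-1) ^ k * rise b k /
        (M.factorial * rise (1 + a - b) (k + M) *
          (rise (a + 1) (k + k) * rise (a + 1 + 2 * k) M)) *
          ((M.choose s : ℚ) * ((-1) ^ s * rise (b + k) s *
            rise (a + 1 + 2 * k + s) (M - s))) := by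
        refine sum_congr rfl fun s hs => ?_
        obtain ⟨j, rfl⟩ := Nat.exists_eq_add_of_le (Nat.lt_succ_iff.mp (mem_range.mp hs))
        rw [show k + (s + j) - (k + s) = j by omega, Nat.add_sub_cancel_left, r0,
          rise_add (a + 1 + 2 * k) s j, rise_add b k s, pow_add,
          factorial_add_eq s j]
        have h1 := rise_ne_zero hC (s + j)
        rw [rise_add] at h1
        have h2 := left_ne_zero_of_mul h1
        have h3 := right_ne_zero_of_mul h1
        have h4 : ((s + j).choose s : ℚ) ≠ 0 := by
          exact_mod_cast (Nat.choose_pos (Nat.le_add_right s j)).ne'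
        have h5 := hf s
        have h6 := hf j
        generalize rise (a + 1 + 2 * k + s) j = R₁ at h3 ⊢
        generalize rise (a + 1 + 2 * k) s = R₂ at h2 ⊢
        field_simp
    _ = _ := by
        rw [← mul_sum, S, r0 M, bN]
        rw [bN] at hbN
        have h1 := right_ne_zero_of_mul hbN
        have h3 := hf M
        field_simp

open Finset in
/-- The unit Bailey pair. -/
lemma bailey_unit (a : ℚ) (N : ℕ) (ha : ∀ i : ℕ, a + i ≠ 0) :
    bailey a (fun k => (-1) ^ k * (a + 2 * k) * rise a k / k.factorial) N =
      if N = 0 then a else 0 := by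
  rcases N with _ | M
  -- The value is a, not 1, because α carries a + 2k in place of (a + 2k)/a.
  · simp [bailey]
  rw [if_neg (Nat.succ_ne_zero M)]
  have hf : ∀ n : ℕ, (n.factorial : ℚ) ≠ 0 := fun n => by exact_mod_cast n.factorial_ne_zero
  have ha1 : ∀ i : ℕ, a + 1 + i ≠ 0 := fun i => by
    have := ha (1 + i); push_cast at this; rwa [← add_assoc] at this
  calc _ = ∑ k ∈ range (M + 2), a / (M + 1).factorial *
        ((-1) ^ k * ((M + 1).choose k : ℚ) * (a + 2 * k) / rise (a + k) (M + 2)) := by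
        refine sum_congr rfl fun k hk => ?_
        have hkM := Nat.lt_succ_iff.mp (mem_range.mp hk)
        obtain ⟨j, hj⟩ := Nat.exists_eq_add_of_le hkM
        have h0 : ∀ i : ℕ, a + k + i ≠ 0 := fun i => by
          have := ha (k + i); push_cast at this; rwa [← add_assoc] at this
        have e : rise a k * rise (a + k) (M + 2) = a * rise (a + 1) (M + 1 + k) := by
          rw [← rise_add, ← rise_succ']
          congr 1; ring
        have h1 := rise_ne_zero ha1 (M + 1 + k)
        have h2 := rise_ne_zero h0 (M + 2)
        have h3 := hf k
        have h4 := hf j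
        have h5 : ((k + j).choose k : ℚ) ≠ 0 := by
          exact_mod_cast (Nat.choose_pos (Nat.le_add_right k j)).ne'
        rw [hj] at *
        rw [Nat.add_sub_cancel_left, factorial_add_eq k j]
        field_simp
        linear_combination (a + 2 * k) * e
    _ = 0 := by rw [← mul_sum, sum_alternating_choose_div_rise M a ha, mul_zero]

/-! ### The chain with parameters -n and a = d - n -/

/-- The iterated coefficients `β` of the Bailey chain with all parameters equal to `-n`, relative to
`a = d - n`, normalized by the leading coefficient. -/
def chainCoeff (n : ℕ) (d : ℚ) : ℕ → ℕ → ℚ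
  | 0, N => if N = 0 then 1 else 0
  | p + 1, N => ∑ j ∈ Finset.range (N + 1), rise (-n) j * rise (-n) j * rise (n + 1 + d) (N - j) /
      ((N - j).factorial * (rise (1 + d) N * rise (1 + d) N)) * chainCoeff n d p j

/-- The chain coefficients at `d = 0`, rescaled by squared factorials. -/
def chainSum (n : ℕ) : ℕ → ℕ → ℚ
  | 0, N => if N = 0 then 1 else 0
  | p + 1, N => ∑ j ∈ Finset.range (N + 1),
      (n.choose j : ℚ) ^ 2 * (n + (N - j)).choose n * chainSum n p j

lemma chainCoeff_zero_right (n p N : ℕ) (hN : N ≤ n) :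
    chainCoeff n 0 p N * (N.factorial : ℚ) ^ 2 = chainSum n p N := by
  induction p generalizing N with
  | zero =>
    simp only [chainCoeff, chainSum]
    split_ifs with h <;> simp [h]
  | succ p ih =>
    simp only [chainCoeff, chainSum, Finset.sum_mul]
    refine Finset.sum_congr rfl fun j hj => ?_
    have hjN := Nat.lt_succ_iff.mp (Finset.mem_range.mp hj)
    have hf : ∀ n : ℕ, (n.factorial : ℚ) ≠ 0 := fun n => by exact_mod_cast n.factorial_ne_zero
    rw [← ih j (hjN.trans hN), add_zero, add_zero, rise_one, rise_natCast_succ,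
      rise_neg_natCast (hjN.trans hN)]
    have h1 := hf N
    have h2 := hf (N - j)
    have h3 : ((-1 : ℚ) ^ j) ^ 2 = 1 := by rw [← pow_mul, mul_comm, pow_mul]; simp
    field_simp
    linear_combination (n.choose j : ℚ) ^ 2 * (n + (N - j)).choose n * chainCoeff n 0 p j * h3

lemma continuousAt_rise {f : ℚ → ℚ} {x : ℚ} (hf : ContinuousAt f x) (k : ℕ) :
    ContinuousAt (fun d => rise (f d) k) x := by
  induction k with
  | zero => simpa using continuousAt_const
  | succ k ih =>
    simp only [rise_succ]
    exact ih.mul (hf.add continuousAt_const)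

lemma continuousAt_chainCoeff (n p N : ℕ) : ContinuousAt (fun d => chainCoeff n d p N) 0 := by
  induction p generalizing N with
  | zero => simpa only [chainCoeff] using continuousAt_const
  | succ p ih =>
    simp only [chainCoeff]
    refine tendsto_finsetSum _ fun j _ => ?_
    have h1 : ContinuousAt (fun d : ℚ => rise (n + 1 + d) (N - j)) 0 :=
      continuousAt_rise (by fun_prop) _
    have h2 : ContinuousAt (fun d : ℚ => rise (1 + d) N) 0 := continuousAt_rise (by fun_prop) _
    have h3 : ((N - j).factorial : ℚ) * (rise (1 + 0) N * rise (1 + 0) N) ≠ 0 := by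
      rw [add_zero, rise_one]
      have := N.factorial_ne_zero
      have := (N - j).factorial_ne_zero
      positivity
    exact ((continuousAt_const.mul h1).div (continuousAt_const.mul (h2.mul h2)) h3).mul (ih j)

open Finset in
lemma bailey_chain (n p : ℕ) (d : ℚ) (hd : ∀ z : ℤ, d ≠ z) (N : ℕ) :
    bailey (d - n) (fun k => (rise (-n) k * rise (-n) k / (rise (1 + d) k * rise (1 + d) k)) ^ p *
      ((-1) ^ k * (d - n + 2 * k) * rise (d - n) k / k.factorial)) N =
      (d - n) * chainCoeff n d p N := by
  -- Non-integrality of d keeps every denominator nonzero; at d = 0 the factor (a+1)_j can vanish.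
  have ha : ∀ i : ℕ, d - n + i ≠ 0 := fun i h => hd (n - i) (by push_cast; linarith)
  have ha1 : ∀ i : ℕ, d - n + 1 + i ≠ 0 := fun i h => hd (n - i - 1) (by push_cast; linarith)
  have hb : ∀ i : ℕ, 1 + (d - n) - (-n) + i ≠ 0 := fun i h => hd (-1 - i) (by push_cast; linarith)
  induction p generalizing N with
  | zero =>
    simp only [pow_zero, one_mul, chainCoeff]
    rw [bailey_unit _ _ ha]
    simp
  | succ p ih =>
    have e1 : 1 + (d - n) - (-n) = 1 + d := by ring
    have e2 : 1 + d - -(n : ℚ) = n + 1 + d := by ring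
    have := bailey_step (d - n) (-n) (-n) (fun k =>
      (rise (-n) k * rise (-n) k / (rise (1 + d) k * rise (1 + d) k)) ^ p *
      ((-1) ^ k * (d - n + 2 * k) * rise (d - n) k / k.factorial)) N ha1 hb hb
    rw [e1, e2] at this
    simp only [pow_succ', mul_assoc] at this ih ⊢
    rw [← this, chainCoeff, mul_sum]
    refine sum_congr rfl fun j _ => ?_
    rw [ih]
    ring

open Finset in
/-- The terminating very-well-poised sum produced by the Bailey chain, for generic `d`. -/
lemma sum_well_poised (ν m : ℕ) (d : ℚ) (hd : ∀ z : ℤ, d ≠ z) :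
    ∑ k ∈ range (ν + 1 + 1), (d - (ν + 1 : ℕ) + 2 * k) * ((-1) ^ k * rise (d - (ν + 1 : ℕ)) k /
        k.factorial * (rise (-(ν + 1 : ℕ)) k / rise (1 + d) k) ^ (2 * m + 2)) =
      d * (rise (d - ν) ν * (ν + 1).factorial * (d - (ν + 1 : ℕ)) *
        ∑ j ∈ range (ν + 1 + 1), (-1) ^ j * rise (-(ν + 1 : ℕ)) j /
          ((ν + 1 - j).factorial * rise (1 + d) (ν + 1)) * chainCoeff (ν + 1) d m j) := by
  set n := ν + 1 with hn
  have ha1 : ∀ i : ℕ, d - n + 1 + i ≠ 0 := fun i h => hd (n - i - 1) (by push_cast; linarith)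
  have hb : ∀ i : ℕ, 1 + (d - n) - (-n) + i ≠ 0 := fun i h => hd (-1 - i) (by push_cast; linarith)
  have h1d : ∀ i : ℕ, 1 + d + i ≠ 0 := fun i h => hd (-1 - i) (by push_cast; linarith)
  have e1 : 1 + (d - n) - (-n) = 1 + d := by ring
  have step := bailey_step_limit (d - n) (-n) (fun k =>
      (rise (-n) k * rise (-n) k / (rise (1 + d) k * rise (1 + d) k)) ^ m *
      ((-1) ^ k * (d - n + 2 * k) * rise (d - n) k / k.factorial)) n ha1 hb
  rw [e1] at step
  simp only [bailey_chain n m d hd] at step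
  -- This product runs through d itself, which is the source of the factor d; what follows it is
  -- (1+d)_k.
  have r0 : ∀ k, rise (d - n + 1) (n + k) = d * rise (d - ν) ν * rise (1 + d) k := by
    intro k
    rw [rise_add, hn, rise_succ]
    push_cast
    rw [show d - ((ν : ℚ) + 1) + 1 = d - ν by ring, show d - ν + ((ν : ℚ) + 1) = 1 + d by ring]
    ring
  have hr := rise_ne_zero ha1 n
  have r00 := r0 0
  rw [add_zero, rise_zero, mul_one] at r00
  rw [r00] at hr
  have hd0 := left_ne_zero_of_mul hr
  have hr0 := right_ne_zero_of_mul hr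
  have hf : ∀ n : ℕ, (n.factorial : ℚ) ≠ 0 := fun n => by exact_mod_cast n.factorial_ne_zero
  calc _ = d * rise (d - ν) ν * n.factorial * bailey (d - n) (fun k =>
        (-1) ^ k * rise (-n) k / rise (1 + d) k *
        ((rise (-n) k * rise (-n) k / (rise (1 + d) k * rise (1 + d) k)) ^ m *
      ((-1) ^ k * (d - n + 2 * k) * rise (d - n) k / k.factorial))) n := by
        rw [bailey, mul_sum]
        refine sum_congr rfl fun k hk => ?_
        have hkn := Nat.lt_succ_iff.mp (mem_range.mp hk)
        have h1 := rise_ne_zero h1d k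
        have h2 := hf k
        have h3 := hf (n - k)
        have h5 : ((-1 : ℚ) ^ k) ^ 2 = 1 := by rw [← pow_mul, mul_comm, pow_mul]; simp
        -- The weight 1/(n-k)! supplies one more (-n)_k, and `r0` one more 1/(1+d)_k, raising the
        -- exponent 2m + 1 to 2m + 2.
        have h4 : (n.factorial : ℚ) = (-1) ^ k * rise (-n) k * (n - k).factorial := by
          rw [rise_neg_natCast hkn, ← Nat.choose_mul_factorial_mul_factorial hkn]
          push_cast
          linear_combination (-(n.choose k * k.factorial * (n - k).factorial : ℚ)) * h5
        rw [r0, h4, pow_add, pow_mul, div_pow _ _ 2, sq (rise _ k), sq (rise (1 + d) k)]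
        generalize (rise (-n) k * rise (-n) k / (rise (1 + d) k * rise (1 + d) k)) ^ m = X
        rcases neg_one_pow_eq_or ℚ k with h | h <;> rw [h] <;> field_simp
    _ = _ := by
        rw [← step, mul_sum, mul_sum, mul_sum]
        refine sum_congr rfl fun j _ => ?_
        ring

/-! ### Differentiation at d = 0 -/

/-- The logarithmic derivative is the sum of 1/(i - n) over i < k. -/
lemma hasDerivAt_rise_neg (n k : ℕ) (hk : k ≤ n) :
    HasDerivAt (fun d : ℚ => rise (d - n) k)
      (rise (-n) k * (harmonic (n - k) - harmonic n)) 0 := by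
  induction k with
  | zero => simpa using hasDerivAt_const (0 : ℚ) (1 : ℚ)
  | succ k ih =>
    obtain ⟨j, rfl⟩ := Nat.exists_eq_add_of_le hk
    simp only [rise_succ]
    have h1 := ((hasDerivAt_id (0 : ℚ)).sub_const ((k + 1 + j : ℕ) : ℚ)).add_const (k : ℚ)
    refine ((ih (by omega)).fun_mul h1).congr_deriv ?_
    have e := harmonic_succ j
    rw [Nat.add_sub_cancel_left, show k + 1 + j - k = j + 1 by omega, e]
    simp only [id, zero_sub]
    push_cast
    have : (j : ℚ) + 1 ≠ 0 := by positivity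
    field_simp
    ring

lemma hasDerivAt_rise_one_add (k : ℕ) :
    HasDerivAt (fun d : ℚ => rise (1 + d) k) (k.factorial * harmonic k) 0 := by
  induction k with
  | zero => simpa using hasDerivAt_const (0 : ℚ) (1 : ℚ)
  | succ k ih =>
    simp only [rise_succ]
    have h1 := ((hasDerivAt_id (0 : ℚ)).const_add (1 : ℚ)).add_const (k : ℚ)
    refine (ih.fun_mul h1).congr_deriv ?_
    rw [add_zero, rise_one, harmonic_succ, Nat.factorial_succ]
    simp only [id]
    push_cast
    have : (k : ℚ) + 1 ≠ 0 := by positivity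
    field_simp
    ring

/-- The derivative at `d = 0` of a summand of the very-well-poised sum. -/
lemma hasDerivAt_well_poised_term (n m k : ℕ) (hk : k ≤ n) :
    HasDerivAt (fun d : ℚ => (d - n + 2 * k) * ((-1) ^ k * rise (d - n) k /
        k.factorial * (rise (-n) k / rise (1 + d) k) ^ (2 * m + 2)))
      ((n.choose k : ℚ) ^ (2 * m + 3) * (1 + (n - 2 * k) * (harmonic n - harmonic (n - k)) +
        (2 * m + 2) * ((n - 2 * k) * harmonic k))) 0 := by
  have hf : (k.factorial : ℚ) ≠ 0 := by exact_mod_cast k.factorial_ne_zero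
  have h0 : rise (1 + 0) k ≠ 0 := by rwa [add_zero, rise_one]
  have h1 := ((hasDerivAt_id (0 : ℚ)).sub_const (n : ℚ)).add_const (2 * k : ℚ)
  have h2 := ((hasDerivAt_rise_neg n k hk).const_mul ((-1 : ℚ) ^ k)).div_const (k.factorial : ℚ)
  have h3 := (((hasDerivAt_rise_one_add k).fun_inv h0).const_mul (rise (-n) k)).fun_pow (2 * m + 2)
  have h4 := h1.fun_mul (h2.fun_mul h3)
  simp only [← div_eq_mul_inv] at h4
  refine h4.congr_deriv ?_
  have e1 : (-1 : ℚ) ^ k * ((-1) ^ k * (n.choose k * k.factorial)) / k.factorial = n.choose k := by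
    rcases neg_one_pow_eq_or ℚ k with h | h <;> rw [h] <;> field_simp
  have e2 : ((-1 : ℚ) ^ k * (n.choose k * k.factorial) / k.factorial) ^ (2 * m + 1) =
      (-1) ^ k * (n.choose k : ℚ) ^ (2 * m + 1) := by
    rw [← mul_assoc, mul_div_cancel_right₀ _ hf, mul_pow, ← pow_mul, mul_comm k, pow_mul,
      Odd.neg_one_pow ⟨m, rfl⟩]
  have e3 : ((-1 : ℚ) ^ k * (n.choose k * k.factorial) / k.factorial) ^ (2 * m + 2) =
      (n.choose k : ℚ) ^ (2 * m + 2) := by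
    rw [← mul_assoc, mul_div_cancel_right₀ _ hf, mul_pow, ← pow_mul, mul_comm k, pow_mul,
      Even.neg_one_pow ⟨m + 1, by ring⟩, one_pow, one_mul]
  simp only [id, zero_sub, add_zero, rise_one, rise_neg_natCast hk]
  rw [show 2 * m + 2 - 1 = 2 * m + 1 by omega, e1, e2, e3]
  push_cast
  rcases neg_one_pow_eq_or ℚ k with h | h <;> rw [h] <;> field_simp <;> ring

open Finset in
/-- Reflection `k ↦ n - k` turns the derivative of the very-well-poised sum into `harmonicT`. -/
lemma sum_deriv_eq_harmonicT (n m : ℕ) :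
    ∑ k ∈ range (n + 1), (n.choose k : ℚ) ^ (2 * m + 3) *
      (1 + (n - 2 * k) * (harmonic n - harmonic (n - k)) +
        (2 * m + 2) * ((n - 2 * k) * harmonic k)) = harmonicT n (2 * (m : ℤ) + 3) := by
  -- The weight n - 2k is odd under reflection, so the `harmonic (n - k)` term adds one copy to the
  -- 2m + 2 of `harmonic k`, while `r2` removes `harmonic n`.
  have r1 : ∑ k ∈ range (n + 1), (n.choose k : ℚ) ^ (2 * m + 3) * ((n - 2 * k) *
      harmonic (n - k)) =
      - ∑ k ∈ range (n + 1), (n.choose k : ℚ) ^ (2 * m + 3) * ((n - 2 * k) * harmonic k) := by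
    rw [← sum_range_reflect, ← sum_neg_distrib]
    refine sum_congr rfl fun k hk => ?_
    have hkn := Nat.lt_succ_iff.mp (mem_range.mp hk)
    rw [show n + 1 - 1 - k = n - k by omega, Nat.choose_symm hkn, Nat.sub_sub_self hkn,
      Nat.cast_sub hkn]
    ring
  have r2 : ∑ k ∈ range (n + 1), (n.choose k : ℚ) ^ (2 * m + 3) * ((n : ℚ) - 2 * k) = 0 := by
    have : ∑ k ∈ range (n + 1), (n.choose k : ℚ) ^ (2 * m + 3) * ((n : ℚ) - 2 * k) =
        - ∑ k ∈ range (n + 1), (n.choose k : ℚ) ^ (2 * m + 3) * ((n : ℚ) - 2 * k) := by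
      conv_lhs => rw [← sum_range_reflect]
      rw [← sum_neg_distrib]
      refine sum_congr rfl fun k hk => ?_
      have hkn := Nat.lt_succ_iff.mp (mem_range.mp hk)
      rw [show n + 1 - 1 - k = n - k by omega, Nat.choose_symm hkn, Nat.cast_sub hkn]
      ring
    linarith
  have r3 : harmonicT n (2 * (m : ℤ) + 3) = ∑ k ∈ range (n + 1), (n.choose k : ℚ) ^ (2 * m + 3) +
      (2 * m + 3) * ∑ k ∈ range (n + 1), (n.choose k : ℚ) ^ (2 * m + 3) *
        ((n - 2 * k) * harmonic k) := by
    rw [harmonicT, mul_sum, ← sum_add_distrib]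
    refine sum_congr rfl fun k _ => ?_
    rw [show (2 * (m : ℤ) + 3) = ((2 * m + 3 : ℕ) : ℤ) by push_cast; ring, zpow_natCast]
    push_cast
    ring
  rw [r3]
  calc _ = ∑ k ∈ range (n + 1), (n.choose k : ℚ) ^ (2 * m + 3) +
      harmonic n * ∑ k ∈ range (n + 1), (n.choose k : ℚ) ^ (2 * m + 3) * ((n : ℚ) - 2 * k) -
      ∑ k ∈ range (n + 1), (n.choose k : ℚ) ^ (2 * m + 3) * ((n - 2 * k) * harmonic (n - k)) +
      (2 * m + 2) * ∑ k ∈ range (n + 1), (n.choose k : ℚ) ^ (2 * m + 3) *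
        ((n - 2 * k) * harmonic k) := by
        simp only [mul_sum, ← sum_add_distrib, ← sum_sub_distrib]
        refine sum_congr rfl fun k _ => ?_
        ring
    _ = _ := by rw [r1, r2]; ring

/-- A function of the form `d * R d` near, but not at, `0` with `R` continuous has derivative
`R 0`, provided that it is differentiable. -/
lemma deriv_eq_of_eventually_eq_mul {G R : ℚ → ℚ} {G' : ℚ} (hG : HasDerivAt G G' 0)
    (hR : ContinuousAt R 0) (h : ∀ᶠ d in nhdsWithin (0 : ℚ) {0}ᶜ, G d = d * R d) : G' = R 0 := by
  have hne := NormedField.nhdsNE_neBot (0 : ℚ)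
  -- The vanishing at 0 comes from continuity, since the factorization is known only off 0.
  have g0 : G 0 = 0 := by
    have h1 := hG.continuousAt.tendsto.mono_left (nhdsWithin_le_nhds (s := {0}ᶜ))
    have h2 := (Filter.tendsto_id.mul hR.tendsto).mono_left (nhdsWithin_le_nhds (s := {0}ᶜ))
    have h3 := tendsto_nhds_unique h1 (h2.congr' (h.mono fun d hd => hd.symm))
    simpa using h3
  refine tendsto_nhds_unique hG.tendsto_slope
    ((hR.tendsto.mono_left nhdsWithin_le_nhds).congr' ?_)
  filter_upwards [h, self_mem_nhdsWithin] with d hd hd0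
  have : d ≠ 0 := hd0
  rw [slope_def_field, hd, g0]
  field_simp
  ring

open Finset in
lemma harmonicT_eq_chainSum (n m : ℕ) :
    harmonicT n (2 * (m : ℤ) + 3) =
      (-1) ^ n * ∑ j ∈ range (n + 1), (n.choose j : ℚ) ^ 2 * chainSum n m j := by
  -- Extracting d from (d-n+1)_n requires n ≥ 1.
  rcases n with _ | ν
  · have : ∀ m, chainSum 0 m 0 = 1 := fun m => by
      induction m with
      | zero => simp [chainSum]
      | succ m ih => simp [chainSum, ih]
    simp [harmonicT, this]
  rw [← sum_deriv_eq_harmonicT]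
  have hG := HasDerivAt.fun_sum (u := range (ν + 1 + 1)) fun k hk =>
    hasDerivAt_well_poised_term (ν + 1) m k (Nat.lt_succ_iff.mp (mem_range.mp hk))
  have hR : ContinuousAt (fun d : ℚ => rise (d - ν) ν * (ν + 1).factorial * (d - (ν + 1 : ℕ)) *
        ∑ j ∈ range (ν + 1 + 1), (-1) ^ j * rise (-(ν + 1 : ℕ)) j /
          ((ν + 1 - j).factorial * rise (1 + d) (ν + 1)) * chainCoeff (ν + 1) d m j) 0 := by
    have h1 : ContinuousAt (fun d : ℚ => rise (d - ν) ν) 0 := continuousAt_rise (by fun_prop) _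
    refine ((h1.mul continuousAt_const).mul (by fun_prop)).mul (tendsto_finsetSum _ fun j _ => ?_)
    have h2 : ContinuousAt (fun d : ℚ => rise (1 + d) (ν + 1)) 0 :=
      continuousAt_rise (by fun_prop) _
    refine (continuousAt_const.div (continuousAt_const.mul h2) ?_).mul (continuousAt_chainCoeff _ _ _)
    change ((ν + 1 - j).factorial : ℚ) * rise (1 + 0) (ν + 1) ≠ 0
    rw [add_zero, rise_one]
    have := (ν + 1).factorial_ne_zero
    have := (ν + 1 - j).factorial_ne_zero
    positivity
  rw [deriv_eq_of_eventually_eq_mul hG hR ?_]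
  · rw [mul_sum, mul_sum]
    refine sum_congr rfl fun j hj => ?_
    have hjn := Nat.lt_succ_iff.mp (mem_range.mp hj)
    rw [zero_sub, zero_sub, add_zero, rise_one, rise_neg_natCast le_rfl, rise_neg_natCast hjn,
      ← chainCoeff_zero_right _ _ _ hjn, Nat.choose_self]
    have hf : ∀ n : ℕ, (n.factorial : ℚ) ≠ 0 := fun n => by exact_mod_cast n.factorial_ne_zero
    have h1 := hf j
    have h2 := hf (ν + 1 - j)
    have h3 := hf ν
    have h4 := Nat.choose_mul_factorial_mul_factorial hjn
    have h5 : (((ν + 1).choose j * j.factorial * (ν + 1 - j).factorial : ℕ) : ℚ) =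
      (ν + 1) * ν.factorial := by rw [h4, Nat.factorial_succ]; push_cast; ring
    push_cast [Nat.factorial_succ] at h5 ⊢
    have h6 : (ν : ℚ) + 1 ≠ 0 := by positivity
    rw [pow_succ]
    rcases neg_one_pow_eq_or ℚ j with h | h <;> rw [h] <;> field_simp <;>
      linear_combination ((ν + 1).choose j * chainCoeff (ν + 1) 0 m j) * h5
  -- The only integer in this neighbourhood is 0.
  · have : ∀ᶠ d : ℚ in nhds 0, |d| < 1 := by
      have : ContinuousAt (fun d : ℚ => |d|) 0 := by fun_prop
      exact this.eventually_lt_const (by simp)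
    filter_upwards [nhdsWithin_le_nhds this, self_mem_nhdsWithin] with d h1 h0
    have h0' : d ≠ 0 := h0
    refine sum_well_poised ν m d fun z hz => h0' ?_
    rw [hz] at h1 ⊢
    have h2 : |z| < 1 := by exact_mod_cast h1
    rw [Int.abs_lt_one_iff.mp h2, Int.cast_zero]

/-! ### Unrolling the recursion over weak chains -/

open Finset in
lemma sum_weakChains_succ (p n : ℕ) (F : (Fin (p + 2) → ℕ) → ℚ) :
    ∑ i ∈ weakChains (p + 2) n, F i = ∑ i ∈ weakChains (p + 1) n,
      ∑ x ∈ (range (n + 1)).filter fun x => i (Fin.last p) ≤ x,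
        F (Fin.snoc (α := fun _ => ℕ) i x) := by
  rw [sum_sigma']
  refine sum_nbij' (fun i => ⟨fun r => i r.castSucc, i (Fin.last (p + 1))⟩)
    (fun q => Fin.snoc (α := fun _ => ℕ) q.1 q.2) ?_ ?_ ?_ ?_ ?_
  · intro i hi
    simp only [weakChains, mem_filter, Fintype.mem_piFinset, mem_sigma] at hi ⊢
    exact ⟨⟨fun r => hi.1 _, fun r s h => hi.2 _ _ (by simpa using h)⟩, hi.1 _,
      hi.2 _ _ (Fin.le_last _)⟩
  · rintro ⟨i, x⟩ hi
    simp only [weakChains, mem_filter, Fintype.mem_piFinset, mem_sigma] at hi ⊢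
    obtain ⟨⟨h1, h2⟩, h3, h4⟩ := hi
    refine ⟨fun r => ?_, fun r s hrs => ?_⟩
    · refine Fin.lastCases ?_ (fun r => ?_) r
      · simpa using h3
      · simpa using h1 r
    · induction s using Fin.lastCases with
      | last =>
        induction r using Fin.lastCases with
        | last => simp
        | cast r => simpa using (h2 r _ (Fin.le_last _)).trans h4
      | cast s =>
        induction r using Fin.lastCases with
        | last => exact absurd hrs (by simp [Fin.le_def, Fin.castSucc]; omega)
        | cast r => simpa using h2 r s (by simpa using hrs)
  · intro i _
    exact Fin.snoc_init_self (α := fun _ => ℕ) i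
  · rintro ⟨i, x⟩ _
    simp
  · intro i _
    exact congrArg F (Fin.snoc_init_self (α := fun _ => ℕ) i).symm

-- Level 0 acts as a virtual entry i_0 = 0, which explains the unpaired factor at i_1.
open Finset in
lemma chainSum_one (n N : ℕ) : chainSum n 1 N = (n + N).choose n := by
  rw [chainSum, sum_eq_single_of_mem 0 (by simp)]
  · simp [chainSum]
  · intro j _ hj
    simp [chainSum, hj]

open Finset in
/-- The sum over weak chains, with an arbitrary weight on the last entry. -/
lemma sum_weakChains_mul_prod (p n : ℕ) (φ : ℕ → ℚ) :
    ∑ i ∈ weakChains (p + 1) n, φ (i (Fin.last p)) * ((n + i 0).choose n : ℚ) *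
      ∏ r : Fin p, ((n.choose (i r.castSucc) : ℚ) ^ 2 *
        ((n + (i r.succ - i r.castSucc)).choose n : ℚ)) =
      ∑ j ∈ range (n + 1), φ j * chainSum n (p + 1) j := by
  induction p generalizing φ with
  | zero =>
    refine sum_nbij' (fun i => i 0) (fun x _ => x) ?_ ?_ ?_ ?_ ?_
    · intro i hi
      simp only [weakChains, mem_filter, Fintype.mem_piFinset] at hi
      exact hi.1 0
    · intro x hx
      simp only [weakChains, mem_filter, Fintype.mem_piFinset]
      exact ⟨fun _ => hx, fun _ _ _ => le_rfl⟩
    · intro i _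
      funext r
      rw [show r = 0 from Fin.ext (by omega)]
    · intro x _
      rfl
    · intro i _
      simp [chainSum_one]
  | succ p ih =>
    rw [sum_weakChains_succ]
    -- The sum over the last entry is absorbed into the weight on the one before it; hence the
    -- arbitrary φ.
    have := ih fun y => (n.choose y : ℚ) ^ 2 *
      ∑ x ∈ (range (n + 1)).filter fun x => y ≤ x, ((n + (x - y)).choose n : ℚ) * φ x
    calc _ = _ := ?_
      _ = _ := this
      _ = _ := ?_
    · refine sum_congr rfl fun i _ => ?_
      rw [mul_sum, sum_mul, sum_mul]
      refine sum_congr rfl fun x _ => ?_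
      rw [Fin.prod_univ_castSucc]
      have e0 : Fin.snoc (α := fun _ => ℕ) i x 0 = i 0 :=
        Fin.snoc_castSucc (α := fun _ => ℕ) x i 0
      simp only [e0, Fin.succ_castSucc, Fin.snoc_castSucc, Fin.succ_last, Fin.snoc_last]
      ring
    · simp only [mul_sum, sum_mul]
      simp only [sum_filter]
      rw [sum_comm]
      refine sum_congr rfl fun x hx => ?_
      rw [← sum_filter, chainSum, mul_sum]
      refine sum_congr ?_ fun y _ => by ring
      ext y
      simp only [mem_filter, mem_range] at hx ⊢
      omega

theorem mainTheorem2 (m n : ℕ) (hm : 1 ≤ m) :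
    harmonicT n (2 * (m : ℤ) + 3) =
      (-1 : ℚ) ^ n * ∑ i ∈ weakChains m n,
        (n.choose (i ⟨m - 1, by omega⟩) : ℚ) ^ 2 * ((n + i ⟨0, by omega⟩).choose n : ℚ) *
          ∏ r : Fin (m - 1),
            ((n.choose (i ⟨r.val, by omega⟩) : ℚ) ^ 2 *
              ((n + (i ⟨r.val + 1, by omega⟩ - i ⟨r.val, by omega⟩)).choose n : ℚ)) := by
  obtain ⟨p, rfl⟩ := Nat.exists_eq_add_of_le' hm
  rw [harmonicT_eq_chainSum, ← sum_weakChains_mul_prod p n fun j => (n.choose j : ℚ) ^ 2]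
  rfl
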